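/- Let $(M,g)$ be a smooth Riemannian manifold, let $(N,J,h)$ be a Kähler manifold (a complex manifold with complex structure $J$ and a smooth Riemannian metric $h$ such that $h(J\cdot,J\cdot)=h$ and the $2$-form $h(J\cdot,\cdot)$ is closed), let $\varphi:M\to N$ be a smooth map, and let $V$ be a smooth vector field on $M$. Then the following are equivalent: 1. $\varphi$ is a $V$-pseudo harmonic morphism, that is, - $\varphi$ is $V$-harmonic: its $V$-tension field $\tau_V(\varphi):=\operatorname{trace}_g\nabla d\varphi+d\varphi(V)$ vanishes identically on $M$, and - $\varphi$ is pseudo-horizontally weakly conformal: $[\,d\varphi_x\circ d\varphi_x^{*},\,J_{\varphi(x)}]=0$ for every $x\in M$, where $d\varphi_x^{*}:T_{\varphi(x)}N\to T_xM$ is the adjoint of $d\varphi_x$ with respect to $g$ and $h$; 2. $\varphi$ pulls back local holomorphic functions on $N$ to local $V$-harmonic functions on $M$: for every open set $W\subseteq N$ and every holomorphic function $f:W\to\mathbb{C}$, the function $f\circ\varphi:\varphi^{-1}(W)\to\mathbb{C}$ is smooth and satisfies $\Delta_V(f\circ\varphi):=\Delta(f\circ\varphi)+d(f\circ\varphi)(V)=0$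 on $\varphi^{-1}(W)$, where $\Delta=\operatorname{trace}_g\nabla d$ is the Laplace–Beltrami operator of $g$, extended complex-linearly to complex-valued functions. -/

import Mathlib

open scoped Manifold ContDiff Bundle

noncomputable section

namespace VPHM

/-! ### Complex manifolds as real manifolds -/

/-- A complex manifold (a holomorphic atlas with values in a complex vector space `F`) is in
particular a real analytic manifold, hence a smooth one, for the same charts. -/
instance isManifold_real_of_complex {F : Type*} [NormedAddCommGroup F] [NormedSpace ℂ F]
    {N : Type*} [TopologicalSpace N] [ChartedSpace F N] [IsManifold 𝓘(ℂ, F) ω N] :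
    IsManifold 𝓘(ℝ, F) ω N := by
  apply isManifold_of_contDiffOn
  intro e e' he he'
  have h : e.symm.trans e' ∈ contDiffGroupoid ω 𝓘(ℂ, F) :=
    HasGroupoid.compatible (G := contDiffGroupoid ω 𝓘(ℂ, F)) he he'
  have h1 : ContDiffOn ℂ ω (𝓘(ℂ, F) ∘ e.symm ≫ₕ e' ∘ 𝓘(ℂ, F).symm)
      (𝓘(ℂ, F).symm ⁻¹' (e.symm ≫ₕ e').source ∩ Set.range 𝓘(ℂ, F)) := by
    rw [contDiffGroupoid, mem_groupoid_of_pregroupoid, contDiffPregroupoid] at h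
    exact h.1
  exact h1.restrict_scalars ℝ

section Riemannian

variable {E : Type*} [NormedAddCommGroup E] [NormedSpace ℝ E]
  {M : Type*} [TopologicalSpace M] [ChartedSpace E M]

/-! ### Local coordinate expressions -/

/-- The coordinate expression, in the chart `χ` centred at `x₀`, of a field `B` of bilinear forms on
the tangent spaces: the bilinear form
`(u, v) ↦ B (D(χ⁻¹) u, D(χ⁻¹) v)` at the point `q` of the coordinate space. For a Riemannian metric
and coordinate vectors `u = ∂_i`, `v = ∂_j` this is the function `g_{ij}`. -/
def inChart (B : ∀ x : M, TangentSpace 𝓘(ℝ, E) x →L[ℝ] TangentSpace 𝓘(ℝ, E) x →L[ℝ] ℝ)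
    (x₀ : M) (q : E) : E →L[ℝ] E →L[ℝ] ℝ :=
  let χ := extChartAt 𝓘(ℝ, E) x₀
  let D : E →L[ℝ] E := mfderiv 𝓘(ℝ, E) 𝓘(ℝ, E) χ.symm q
  let b : E →L[ℝ] E →L[ℝ] ℝ := B (χ.symm q)
  b.bilinearComp D D

theorem inChart_apply
    (B : ∀ x : M, TangentSpace 𝓘(ℝ, E) x →L[ℝ] TangentSpace 𝓘(ℝ, E) x →L[ℝ] ℝ)
    (x₀ : M) (q u v : E) :
    inChart B x₀ q u v
      = B ((extChartAt 𝓘(ℝ, E) x₀).symm q)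
          (mfderiv 𝓘(ℝ, E) 𝓘(ℝ, E) (extChartAt 𝓘(ℝ, E) x₀).symm q u)
          (mfderiv 𝓘(ℝ, E) 𝓘(ℝ, E) (extChartAt 𝓘(ℝ, E) x₀).symm q v) :=
  rfl

/-- The trace `∑ G^{ij} B(e_i, e_j)` of a bilinear map `B` with respect to an inner product `G`,
where `e` is a basis and `(G^{ij})` is the inverse of the Gram matrix `(G(e_i, e_j))`.
(It does not depend on the basis.) -/
def metricTrace [FiniteDimensional ℝ E] {A : Type*} [AddCommGroup A] [Module ℝ A]
    (G : E →L[ℝ] E →L[ℝ] ℝ) (B : E → E → A) : A :=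
  let e := Module.finBasis ℝ E
  let gram : Matrix (Fin (Module.finrank ℝ E)) (Fin (Module.finrank ℝ E)) ℝ :=
    Matrix.of fun i j => G (e i) (e j)
  ∑ i, ∑ j, gram⁻¹ i j • B (e i) (e j)

variable [IsManifold 𝓘(ℝ, E) ∞ M]

variable (E M) in
/-- Smooth Riemannian metrics on the manifold `M`. -/
abbrev Metric : Type _ :=
  Bundle.ContMDiffRiemannianMetric (IB := 𝓘(ℝ, E)) (n := ∞) (F := E)
    (E := fun x : M => TangentSpace 𝓘(ℝ, E) x)

/-- The Christoffel symbols of the Levi-Civita connection of `g` in the chart centred at `x₀`, at the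
point `q` of the coordinate space. With `G = (g_{ij})` the coordinate expression of the metric,
`Γ(u, v)` is determined by
`2 G(Γ(u, v), w) = ∂_u G(v, w) + ∂_v G(u, w) - ∂_w G(u, v)` for all `w`, that is
`Γ_{ij}^k = ½ ∑_l g^{kl} (∂_i g_{jl} + ∂_j g_{il} - ∂_l g_{ij})` for
`Γ(∂_i, ∂_j) = ∑_k Γ_{ij}^k ∂_k`. -/
def christoffel (g : Metric E M) (x₀ : M) (q : E) (u v : E) : E :=
  let G : E → (E →L[ℝ] E →L[ℝ] ℝ) := inChart g.inner x₀
  let koszul : E →L[ℝ] ℝ := (1 / 2 : ℝ) •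
    (fderiv ℝ (fun p => G p v) q u + fderiv ℝ (fun p => G p u) q v - fderiv ℝ (fun p => G p u v) q)
  (G q).inverse koszul

/-! ### The `V`-Laplacian of functions -/

/-- The Laplace-Beltrami operator at `x`, for functions with values in a real vector space `A`
(here `ℝ` or `ℂ`): in coordinates,
`Δ f = ∑ g^{ij} (∂²f/∂x_i∂x_j - ∑_k Γ_{ij}^k ∂f/∂x_k)`. -/
def laplacian [FiniteDimensional ℝ E] {A : Type*} [NormedAddCommGroup A] [NormedSpace ℝ A]
    (g : Metric E M) (f : M → A) (x : M) : A :=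
  let χ := extChartAt 𝓘(ℝ, E) x
  let q : E := χ x
  let f' : E → A := f ∘ χ.symm
  metricTrace (inChart g.inner x q) fun u v =>
    fderiv ℝ (fderiv ℝ f') q u v - fderiv ℝ f' q (christoffel g x q u v)

/-- The `V`-Laplacian `Δ_V f = Δ f + ⟨V, ∇f⟩`, where `⟨V, ∇f⟩ = df(V)`. -/
def vLaplacian [FiniteDimensional ℝ E] {A : Type*} [NormedAddCommGroup A] [NormedSpace ℝ A]
    (g : Metric E M) (V : ∀ x : M, TangentSpace 𝓘(ℝ, E) x) (f : M → A) (x : M) : A :=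
  let dfV : A := mfderiv 𝓘(ℝ, E) 𝓘(ℝ, A) f x (V x)
  laplacian g f x + dfV

/-- `f` is a (local) `V`-harmonic function on the set `U` (to be used for open `U`): it is smooth
on `U` and `Δ_V f = 0` there. -/
def IsVHarmonicFunOn [FiniteDimensional ℝ E] {A : Type*} [NormedAddCommGroup A] [NormedSpace ℝ A]
    (g : Metric E M) (V : ∀ x : M, TangentSpace 𝓘(ℝ, E) x) (f : M → A) (U : Set M) : Prop :=
  ContMDiffOn 𝓘(ℝ, E) 𝓘(ℝ, A) ∞ f U ∧ ∀ x ∈ U, vLaplacian g V f x = 0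

/-! ### The `V`-tension field of maps -/

section Maps

variable {F : Type*} [NormedAddCommGroup F] [NormedSpace ℝ F]
  {N : Type*} [TopologicalSpace N] [ChartedSpace F N] [IsManifold 𝓘(ℝ, F) ∞ N]

/-- The tension field `τ(φ) = trace ∇dφ` at `x`, an element of the tangent space of `N` at `φ x`.
In coordinates `(x_i)` centred at `x` and `(y_α)` centred at `φ x` it is `∑ τ(φ)^α ∂/∂y_α`, where
`τ(φ)^α = ∑ g^{ij} (∂²φ^α/∂x_i∂x_j - ∑_k Γ_{ij}^k ∂φ^α/∂x_k + ∑ L_{βγ}^α ∂φ^β/∂x_i ∂φ^γ/∂x_j)`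
with `Γ` and `L` the Christoffel symbols of `M` and of `N`. -/
def tensionField [FiniteDimensional ℝ E] (g : Metric E M) (h : Metric F N) (φ : M → N) (x : M) :
    TangentSpace 𝓘(ℝ, F) (φ x) :=
  let χ := extChartAt 𝓘(ℝ, E) x
  let ψ := extChartAt 𝓘(ℝ, F) (φ x)
  let q : E := χ x
  let φ' : E → F := ψ ∘ φ ∘ χ.symm
  let τ : F := metricTrace (inChart g.inner x q) fun u v =>
    fderiv ℝ (fderiv ℝ φ') q u v - fderiv ℝ φ' q (christoffel g x q u v)
      + christoffel h (φ x) (ψ (φ x)) (fderiv ℝ φ' q u) (fderiv ℝ φ' q v)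
  let D : F →L[ℝ] F := mfderiv 𝓘(ℝ, F) 𝓘(ℝ, F) ψ.symm (ψ (φ x))
  D τ

/-- The `V`-tension field `τ_V(φ) = τ(φ) + dφ(V)`. -/
def vTensionField [FiniteDimensional ℝ E] (g : Metric E M) (h : Metric F N) (V : ∀ x : M, TangentSpace 𝓘(ℝ, E) x)
    (φ : M → N) (x : M) : TangentSpace 𝓘(ℝ, F) (φ x) :=
  tensionField g h φ x + mfderiv 𝓘(ℝ, E) 𝓘(ℝ, F) φ x (V x)

/-- A map is `V`-harmonic if its `V`-tension field vanishes identically. -/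
def IsVHarmonicMap [FiniteDimensional ℝ E] (g : Metric E M) (h : Metric F N) (V : ∀ x : M, TangentSpace 𝓘(ℝ, E) x)
    (φ : M → N) : Prop :=
  ∀ x, vTensionField g h V φ x = 0

/-- The adjoint `dφ_x^* : T_{φ(x)} N → T_x M` of the differential with respect to the metrics: it
sends `w` to the vector dual to the linear form `u ↦ h(w, dφ_x u)`. See `adjoint_spec`. -/
def adjointMFDeriv (g : Metric E M) (h : Metric F N) (φ : M → N) (x : M) :
    TangentSpace 𝓘(ℝ, F) (φ x) → TangentSpace 𝓘(ℝ, E) x := fun w =>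
  (g.inner x).inverse ((h.inner (φ x) w).comp (mfderiv 𝓘(ℝ, E) 𝓘(ℝ, F) φ x))

end Maps

/-- A Riemannian metric identifies each tangent space with its dual. -/
theorem inner_isInvertible [FiniteDimensional ℝ E] (g : Metric E M) (x : M) :
    (g.inner x).IsInvertible := by
  let G : E →L[ℝ] E →L[ℝ] ℝ := g.inner x
  have hG : ∀ v : E, v ≠ 0 → 0 < G v v := fun v hv => g.pos x v hv
  have hinj : Function.Injective G := by
    rw [injective_iff_map_eq_zero]
    intro v hv
    by_contra hne
    have := hG v hne
    rw [hv] at this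
    simp at this
  have hfin : Module.finrank ℝ E = Module.finrank ℝ (E →L[ℝ] ℝ) := by
    rw [← (LinearMap.toContinuousLinearMap (𝕜 := ℝ) (E := E) (F' := ℝ)).finrank_eq]
    exact (Subspace.dual_finrank_eq (K := ℝ) (V := E)).symm
  let e := (LinearEquiv.ofInjectiveOfFinrankEq G.toLinearMap hinj hfin).toContinuousLinearEquiv
  exact ⟨e, by ext v w; rfl⟩

theorem adjoint_spec [FiniteDimensional ℝ E] {F : Type*} [NormedAddCommGroup F] [NormedSpace ℝ F]
    {N : Type*} [TopologicalSpace N] [ChartedSpace F N] [IsManifold 𝓘(ℝ, F) ∞ N]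
    (g : Metric E M) (h : Metric F N) (φ : M → N) (x : M)
    (w : TangentSpace 𝓘(ℝ, F) (φ x)) (u : TangentSpace 𝓘(ℝ, E) x) :
    g.inner x (adjointMFDeriv g h φ x w) u
      = h.inner (φ x) w (mfderiv 𝓘(ℝ, E) 𝓘(ℝ, F) φ x u) := by
  have := (ContinuousLinearMap.IsInvertible.inverse_apply_eq (inner_isInvertible g x)
    (y := (h.inner (φ x) w).comp (mfderiv 𝓘(ℝ, E) 𝓘(ℝ, F) φ x))).1 rfl
  rw [adjointMFDeriv, ← this]
  rfl

end Riemannian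

/-! ### Kähler manifolds and pseudo-horizontal weak conformality -/

section Kahler

variable {E : Type*} [NormedAddCommGroup E] [NormedSpace ℝ E]
  {M : Type*} [TopologicalSpace M] [ChartedSpace E M] [IsManifold 𝓘(ℝ, E) ∞ M]
  {F : Type*} [NormedAddCommGroup F] [NormedSpace ℂ F]
  {N : Type*} [TopologicalSpace N] [ChartedSpace F N] [IsManifold 𝓘(ℂ, F) ω N]

/-- The complex structure `J` of a complex manifold: multiplication by `i` on the tangent spaces
(which are copies of `F` through holomorphic charts). -/
def complexStructure (y : N) : TangentSpace 𝓘(ℝ, F) y →L[ℝ] TangentSpace 𝓘(ℝ, F) y :=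
  let J : F →L[ℝ] F := (Complex.I • ContinuousLinearMap.id ℂ F).restrictScalars ℝ
  J

/-- The fundamental 2-form `ω(u, v) = h(J u, v)`. -/
def fundamentalForm (h : Metric F N) (y : N) :
    TangentSpace 𝓘(ℝ, F) y →L[ℝ] TangentSpace 𝓘(ℝ, F) y →L[ℝ] ℝ :=
  (h.inner y).comp (complexStructure y)

/-- `h` is a Kähler metric on the complex manifold `N`: it is Hermitian, `h(Ju, Jv) = h(u, v)`, and
its fundamental form is closed. In the chart centred at `y`, and for constant vectors `u, v, w`,
`dω(u, v, w) = ∂_u ω(v, w) + ∂_v ω(w, u) + ∂_w ω(u, v)`. -/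
structure IsKahler (h : Metric F N) : Prop where
  hermitian : ∀ (y : N) (u v : TangentSpace 𝓘(ℝ, F) y),
    h.inner y (complexStructure y u) (complexStructure y v) = h.inner y u v
  closed : ∀ (y : N) (u v w : F),
    let ω' : F → (F →L[ℝ] F →L[ℝ] ℝ) := inChart (fundamentalForm h) y
    let q : F := extChartAt 𝓘(ℝ, F) y y
    fderiv ℝ (fun p => ω' p v w) q u + fderiv ℝ (fun p => ω' p w u) q v
      + fderiv ℝ (fun p => ω' p u v) q w = 0

/-- `φ` is pseudo-horizontally weakly conformal: `[dφ_x ∘ dφ_x^*, J] = 0` at every point `x`. -/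
def IsPHWC (g : Metric E M) (h : Metric F N) (φ : M → N) : Prop :=
  ∀ (x : M) (w : TangentSpace 𝓘(ℝ, F) (φ x)),
    mfderiv 𝓘(ℝ, E) 𝓘(ℝ, F) φ x (adjointMFDeriv g h φ x (complexStructure (φ x) w))
      = complexStructure (φ x) (mfderiv 𝓘(ℝ, E) 𝓘(ℝ, F) φ x (adjointMFDeriv g h φ x w))

/-- `φ` is a `V`-pseudo harmonic morphism: `V`-harmonic and pseudo-horizontally weakly conformal. -/
structure IsVPseudoHarmonicMorphism [FiniteDimensional ℝ E] (g : Metric E M) (h : Metric F N)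
    (V : ∀ x : M, TangentSpace 𝓘(ℝ, E) x) (φ : M → N) : Prop where
  vHarmonic : IsVHarmonicMap g h V φ
  phwc : IsPHWC g h φ

/-- `φ` pulls back local holomorphic functions on `N` to local `V`-harmonic functions on `M`:
for every open `W ⊆ N` and every `f` holomorphic (complex analytic) on `W`, the function `f ∘ φ` is
`V`-harmonic on `φ⁻¹(W)`. -/
def PullsBackHolomorphicToVHarmonic [FiniteDimensional ℝ E] (g : Metric E M) (V : ∀ x : M, TangentSpace 𝓘(ℝ, E) x)
    (φ : M → N) : Prop :=
  ∀ (W : Set N) (f : N → ℂ), IsOpen W → ContMDiffOn 𝓘(ℂ, F) 𝓘(ℂ, ℂ) ω f W →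
    IsVHarmonicFunOn g V (f ∘ φ) (φ ⁻¹' W)

end Kahler

end VPHM

end

open Filter Topology

noncomputable section

namespace VPHM
-- Metric traces and the linear algebra of the commutation condition.
section Algebra
variable {E : Type*} [NormedAddCommGroup E] [NormedSpace ℝ E] [FiniteDimensional ℝ E]

/-! Fix `x` and use the preferred charts at `x` and `φ x`; the one at `φ x` is holomorphic. Let `T`
be the differential of `φ` in these charts, `f'` the expression of `f`, and `c` the part of the
coordinate formula for `τ_V(φ)` that ignores the metric of `N` (`coordTension`). The chain rule
gives `Δ_V(f ∘ φ) = tr_g f''(T, T) + df'(c)` (`vLaplacian_comp_eq`), while `τ_V(φ) = c + tr_g L(T,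
T)` with `L` the Christoffel symbols of `N` (`vTensionField_eq`).

For holomorphic `f`, the Hessian `f''` is complex bilinear; the Kähler condition makes `L` complex
bilinear too (`christoffel_I_smul_left`). The link with conformality is algebraic: if `T T*`
commutes with `J`, then `tr_g B(T, T) = 0` for every real bilinear `B` with `B(Ju, Jv) = -B(u, v)`
(`metricTrace_comp_eq_zero`); conversely, vanishing for products of two complex linear forms already
forces commutation (`comm_of_metricTrace_eq_zero`).

Under the commutation condition both traces drop out, leaving `τ_V(φ) = c` and `Δ_V(f ∘ φ) =
df'(c)`, so harmonicity gives the pull-back property. Conversely, quadratic test functions `l · m`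
centred at the image point yield the commutation condition, and complex linear test functions then
yield `c = 0`. -/

theorem metricTrace_map {A A' : Type*} [AddCommGroup A] [Module ℝ A] [AddCommGroup A']
    [Module ℝ A'] (L : A →ₗ[ℝ] A') (G : E →L[ℝ] E →L[ℝ] ℝ) (B : E → E → A) :
    L (metricTrace G B) = metricTrace G fun u v => L (B u v) := by
  simp [metricTrace, map_sum]

theorem metricTrace_add {A : Type*} [AddCommGroup A] [Module ℝ A] (G : E →L[ℝ] E →L[ℝ] ℝ)
    (B B' : E → E → A) :
    metricTrace G (fun u v => B u v + B' u v) = metricTrace G B + metricTrace G B' := by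
  simp [metricTrace, Finset.sum_add_distrib]

theorem metricTrace_sum {A ι : Type*} [AddCommGroup A] [Module ℝ A] (s : Finset ι)
    (G : E →L[ℝ] E →L[ℝ] ℝ) (B : ι → E → E → A) :
    metricTrace G (fun u v => ∑ k ∈ s, B k u v) = ∑ k ∈ s, metricTrace G (B k) := by
  simp only [metricTrace, Finset.smul_sum]
  symm
  rw [Finset.sum_comm]
  exact Finset.sum_congr rfl fun i _ => Finset.sum_comm

theorem metricTrace_swap {A : Type*} [AddCommGroup A] [Module ℝ A] (G : E →L[ℝ] E →L[ℝ] ℝ)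
    (hs : ∀ u v, G u v = G v u) (B : E → E → A) :
    metricTrace G (fun u v => B v u) = metricTrace G B := by
  simp only [metricTrace]
  rw [Finset.sum_comm]
  refine Finset.sum_congr rfl fun i _ => Finset.sum_congr rfl fun j _ => ?_
  rw [← Matrix.transpose_apply (Matrix.of _)⁻¹, Matrix.transpose_nonsing_inv]
  have : (Matrix.of fun i j => G (Module.finBasis ℝ E i) (Module.finBasis ℝ E j)).transpose
      = Matrix.of fun i j => G (Module.finBasis ℝ E i) (Module.finBasis ℝ E j) :=
    Matrix.ext fun a b => hs _ _
  rw [this]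

/-- Tracing a linear form `G(s, ·)` against a linear map evaluates the latter at `s`. -/
theorem metricTrace_dual_smul {A : Type*} [AddCommGroup A] [Module ℝ A] (G : E →L[ℝ] E →L[ℝ] ℝ)
    (hG : ∀ v, v ≠ 0 → 0 < G v v) (s : E) (B : E →ₗ[ℝ] A) :
    metricTrace G (fun u v => G s u • B v) = B s := by
  set e := Module.finBasis ℝ E
  set gram : Matrix (Fin (Module.finrank ℝ E)) (Fin (Module.finrank ℝ E)) ℝ :=
    Matrix.of fun i j => G (e i) (e j) with hgram
  -- A nonzero kernel vector of the Gram matrix would give a nonzero vector `G`-orthogonal to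
  -- everything, itself included.
  have hdet : gram.det ≠ 0 := by
    intro h0
    obtain ⟨c, hc, hc0⟩ := Matrix.exists_vecMul_eq_zero_iff.2 h0
    have hv : ∑ i, c i • e i ≠ 0 := fun hz =>
      hc (funext (Fintype.linearIndependent_iff.1 e.linearIndependent c hz))
    refine (hG _ hv).ne' ?_
    have h1 : ∀ j, G (∑ i, c i • e i) (e j) = 0 := fun j => by
      simpa [Matrix.vecMul, dotProduct, hgram] using congrFun hc0 j
    have h2 : (G (∑ i, c i • e i) : E →ₗ[ℝ] ℝ) = 0 := e.ext h1
    exact LinearMap.congr_fun h2 _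
  have h1 : ∀ i, G s (e i) = (Matrix.vecMul (e.repr s) gram) i := fun i => by
    conv_lhs => rw [← e.sum_repr s, map_sum, sum_apply]
    simp [Matrix.vecMul, dotProduct, hgram]
  have h2 : ∀ j, ∑ i, gram⁻¹ i j * G s (e i) = e.repr s j := fun j => by
    have := congrFun (Matrix.vecMul_vecMul (e.repr s) gram gram⁻¹) j
    rw [Matrix.mul_nonsing_inv _ (isUnit_iff_ne_zero.2 hdet), Matrix.vecMul_one] at this
    rw [← this]
    simp only [h1, Matrix.vecMul, dotProduct, mul_comm]
  change ∑ i, ∑ j, gram⁻¹ i j • G s (e i) • B (e j) = B s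
  rw [Finset.sum_comm]
  conv_rhs => rw [← e.sum_repr s]
  simp only [map_sum, map_smul, ← h2, Finset.sum_smul, smul_smul]

variable {F : Type*} [NormedAddCommGroup F] [NormedSpace ℂ F]

theorem bilin_ext (H : F →L[ℝ] F →L[ℝ] ℝ) (hH : ∀ v, v ≠ 0 → 0 < H v v) {a b : F}
    (hab : ∀ w, H a w = H b w) : a = b := by
  by_contra hne
  have := hH (a - b) (sub_ne_zero.2 hne)
  rw [map_sub] at this
  simp [hab] at this

theorem hermitian_skew (H : F →L[ℝ] F →L[ℝ] ℝ)
    (hJ : ∀ u v, H (Complex.I • u) (Complex.I • v) = H u v) (u v : F) :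
    H u (Complex.I • v) = -H (Complex.I • u) v := by
  rw [← hJ u, smul_smul, Complex.I_mul_I]
  simp

/-- If `T T*` commutes with the complex structure, the trace of the pull-back by `T` of a bilinear
map that is anti-invariant under the complex structure vanishes. -/
theorem metricTrace_comp_eq_zero [FiniteDimensional ℂ F] {A : Type*} [AddCommGroup A] [Module ℝ A]
    (G : E →L[ℝ] E →L[ℝ] ℝ) (hG : ∀ v, v ≠ 0 → 0 < G v v)
    (H : F →L[ℝ] F →L[ℝ] ℝ) (hH : ∀ v, v ≠ 0 → 0 < H v v)
    (hJ : ∀ u v, H (Complex.I • u) (Complex.I • v) = H u v)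
    (T : E →L[ℝ] F) (S : F → E) (hS : ∀ w u, G (S w) u = H w (T u))
    (hTS : ∀ w, T (S (Complex.I • w)) = Complex.I • T (S w))
    (B : F →ₗ[ℝ] F →ₗ[ℝ] A) (hB : ∀ u v, B (Complex.I • u) (Complex.I • v) = -B u v) :
    metricTrace G (fun u v => B (T u) (T v)) = 0 := by
  have : FiniteDimensional ℝ F := FiniteDimensional.complexToReal F
  let J : F →ₗ[ℝ] F := (Complex.I • LinearMap.id : F →ₗ[ℂ] F).restrictScalars ℝ
  have hJv : ∀ v, J v = Complex.I • v := fun v => rfl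
  let f := Module.finBasis ℝ F
  have hsurj : ∀ l : F →ₗ[ℝ] ℝ, ∃ w, ∀ z, H w z = l z := by
    let H' : F →ₗ[ℝ] Module.Dual ℝ F :=
      { toFun := fun w => (H w : F →ₗ[ℝ] ℝ)
        map_add' := by intros; ext; simp
        map_smul' := by intros; ext; simp }
    have hinj : Function.Injective H' := fun a b hab =>
      bilin_ext H hH fun w => LinearMap.congr_fun hab w
    have := (LinearMap.injective_iff_surjective_of_finrank_eq_finrank
      (Subspace.dual_finrank_eq (K := ℝ) (V := F)).symm).1 hinj
    intro l
    obtain ⟨w, hw⟩ := this l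
    exact ⟨w, fun z => LinearMap.congr_fun hw z⟩
  -- The `w k` represent the coordinate forms of the basis `f` through `H`, so `B` splits into terms
  -- `H(w k, ·) B(f k, ·)` and each trace can be evaluated by `metricTrace_dual_smul`.
  choose w hw using fun k => hsurj (f.coord k)
  have hexp : ∀ a b, B a b = ∑ k, H (w k) a • B (f k) b := fun a b => by
    conv_lhs => rw [← f.sum_repr a, map_sum, LinearMap.sum_apply]
    simp [hw]
  have h1 : metricTrace G (fun u v => B (T u) (T v)) = ∑ k, B (f k) (T (S (w k))) := by
    simp only [fun u v => hexp (T u) (T v), metricTrace_sum, ← hS]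
    exact Finset.sum_congr rfl fun k _ =>
      metricTrace_dual_smul G hG (S (w k)) ((B (f k)).comp (T : E →ₗ[ℝ] F))
  -- Inserting `J` in both slots leaves the trace unchanged: moving `J` across `H` costs a sign,
  -- commuting it past `T S` produces `J² = -1`, and the signs cancel. Anti-invariance of `B` says
  -- that the trace also changes sign, so it is zero.
  have h2 : metricTrace G (fun u v => B (J (T u)) (J (T v))) = ∑ k, B (f k) (T (S (w k))) := by
    simp only [fun u v => hexp (J (T u)) (J (T v)), metricTrace_sum]
    refine Finset.sum_congr rfl fun k _ => ?_
    simp only [hJv, hermitian_skew H hJ, ← hS, neg_smul]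
    have := metricTrace_dual_smul G hG (S (Complex.I • w k))
      (-((B (f k)).comp (J.comp (T : E →ₗ[ℝ] F))))
    simp only [LinearMap.neg_apply, LinearMap.comp_apply, smul_neg, hJv,
      ContinuousLinearMap.coe_coe, hTS, smul_smul, Complex.I_mul_I] at this
    rw [this]
    simp
  have h3 : metricTrace G (fun u v => B (J (T u)) (J (T v)))
      = -metricTrace G (fun u v => B (T u) (T v)) := by
    simp only [hJv, hB]
    exact (metricTrace_map (-LinearMap.id) G _).symm
  rw [h2, ← h1] at h3
  have h4 : (2 : ℝ) • metricTrace G (fun u v => B (T u) (T v)) = 0 := by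
    rw [two_smul]
    nth_rewrite 1 [h3]
    exact neg_add_cancel _
  exact (smul_eq_zero_iff_right two_ne_zero).1 h4

/-- Every real form `H(w, ·)` is the real part of a complex linear form. For the forms attached to
`w` and `w'`, the real part of the vanishing trace reads `H(w', T S w) + H(w', J T S J w) = 0`. As
`w'` is arbitrary, `J T S J w = -T S w`. -/
theorem comm_of_metricTrace_eq_zero
    (G : E →L[ℝ] E →L[ℝ] ℝ) (hG : ∀ v, v ≠ 0 → 0 < G v v)
    (H : F →L[ℝ] F →L[ℝ] ℝ) (hs : ∀ u v, H u v = H v u) (hH : ∀ v, v ≠ 0 → 0 < H v v)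
    (hJ : ∀ u v, H (Complex.I • u) (Complex.I • v) = H u v)
    (T : E →L[ℝ] F) (S : F → E) (hS : ∀ w u, G (S w) u = H w (T u))
    (h0 : ∀ l m : F →L[ℂ] ℂ, metricTrace G (fun u v => l (T u) * m (T v)) = 0) (w : F) :
    T (S (Complex.I • w)) = Complex.I • T (S w) := by
  let J : F →ₗ[ℝ] F := (Complex.I • LinearMap.id : F →ₗ[ℂ] F).restrictScalars ℝ
  have hJv : ∀ v, J v = Complex.I • v := fun v => rfl
  suffices h : Complex.I • T (S (Complex.I • w)) = -T (S w) by
    have := congrArg (fun z => -(Complex.I • z)) h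
    simpa [smul_smul] using this
  refine bilin_ext H hH fun w' => ?_
  let ext : F → F →L[ℂ] ℂ := fun a => StrongDual.extendRCLike (H a)
  have hext : ∀ a z, (ext a z).re = H a z ∧ (ext a z).im = -H a (Complex.I • z) := by
    intro a z
    simp [ext, StrongDual.extendRCLike_apply]
  have h1 := congrArg (Complex.reLm) (h0 (ext w) (ext w'))
  rw [metricTrace_map] at h1
  simp only [Complex.reLm_coe, Complex.mul_re, (hext _ _).1, (hext _ _).2, 
    hermitian_skew H hJ w, ← hS w, ← hS (Complex.I • w), sub_eq_add_neg, map_zero,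
    metricTrace_add, mul_neg, neg_neg] at h1
  have h2 := metricTrace_dual_smul G hG (S w) ((H w' : F →ₗ[ℝ] ℝ).comp (T : E →ₗ[ℝ] F))
  have h3 := metricTrace_dual_smul G hG (S (Complex.I • w))
    ((H w' : F →ₗ[ℝ] ℝ).comp (J.comp (T : E →ₗ[ℝ] F)))
  simp only [LinearMap.comp_apply, ContinuousLinearMap.coe_coe, hJv, smul_eq_mul] at h2 h3
  rw [h2, h3] at h1
  rw [hs _ w', hs _ w']
  simp only [map_neg]
  linarith

end Algebra
end VPHM

/-! ### Metrics in charts and the Koszul formula. -/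

namespace VPHM

/-- Christoffel symbols differentiate covector-valued functions, whereas smoothness of the metric is
obtained for the scalar functions `G p u v`; in finite dimension the latter suffices. -/
theorem differentiableAt_dual_of_apply {E X : Type*} [NormedAddCommGroup E] [NormedSpace ℝ E]
    [FiniteDimensional ℝ E] [NormedAddCommGroup X] [NormedSpace ℝ X] {A : X → E →L[ℝ] ℝ} {x : X}
    (hA : ∀ b, DifferentiableAt ℝ (fun p => A p b) x) : DifferentiableAt ℝ A x := by
  let e := Module.finBasis ℝ E
  have h : A = fun p => ∑ i, A p (e i) • LinearMap.toContinuousLinearMap (e.coord i) := by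
    funext p
    ext b
    conv_lhs => rw [← e.sum_repr b, map_sum]
    simp [sum_apply, mul_comm]
  rw [h]
  exact DifferentiableAt.fun_sum fun i _ => (hA (e i)).smul_const _

section RealCharts

variable {E : Type*} [NormedAddCommGroup E] [NormedSpace ℝ E]
  {M : Type*} [TopologicalSpace M] [ChartedSpace E M]

theorem extChartAt_comp_symm_eventuallyEq (x : M) :
    (fun z => extChartAt 𝓘(ℝ, E) x ((extChartAt 𝓘(ℝ, E) x).symm z))
      =ᶠ[𝓝 (extChartAt 𝓘(ℝ, E) x x)] id := by
  filter_upwards [extChartAt_target_mem_nhds (I := 𝓘(ℝ, E)) x] with z hz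
  exact (extChartAt 𝓘(ℝ, E) x).right_inv hz

variable [IsManifold 𝓘(ℝ, E) ∞ M]

theorem contMDiffAt_extChartAt_symm (x : M) :
    ContMDiffAt 𝓘(ℝ, E) 𝓘(ℝ, E) ∞ (extChartAt 𝓘(ℝ, E) x).symm (extChartAt 𝓘(ℝ, E) x x) :=
  (contMDiffOn_extChartAt_symm x).contMDiffAt (extChartAt_target_mem_nhds x)

/-- The tangent space at `x` is identified with the model space through this same chart, so the
derivative being computed is that of the chart composed with its inverse. Hence no Jacobian appears
at the centre of a chart. -/
theorem mfderiv_extChartAt_symm_self (x : M) (u : E) :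
    (mfderiv 𝓘(ℝ, E) 𝓘(ℝ, E) (extChartAt 𝓘(ℝ, E) x).symm (extChartAt 𝓘(ℝ, E) x x) u : E) = u := by
  have hd : MDifferentiableAt 𝓘(ℝ, E) 𝓘(ℝ, E) (extChartAt 𝓘(ℝ, E) x).symm
      (extChartAt 𝓘(ℝ, E) x x) := (contMDiffAt_extChartAt_symm x).mdifferentiableAt (by simp)
  have h1 : (mfderiv 𝓘(ℝ, E) 𝓘(ℝ, E) (extChartAt 𝓘(ℝ, E) x).symm (extChartAt 𝓘(ℝ, E) x x) : E →L[ℝ] E)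
      = fderiv ℝ (fun z => extChartAt 𝓘(ℝ, E) ((extChartAt 𝓘(ℝ, E) x).symm (extChartAt 𝓘(ℝ, E) x x))
          ((extChartAt 𝓘(ℝ, E) x).symm z)) (extChartAt 𝓘(ℝ, E) x x) := by
    have h2 := hd.mfderiv
    simp only [ModelWithCorners.range_eq_univ, fderivWithin_univ] at h2
    exact h2
  rw [extChartAt_to_inv, (extChartAt_comp_symm_eventuallyEq x).fderiv_eq] at h1
  exact (congrArg (fun A : E →L[ℝ] E => A u) h1).trans (by simp)

theorem inChart_self (B : ∀ x : M, TangentSpace 𝓘(ℝ, E) x →L[ℝ] TangentSpace 𝓘(ℝ, E) x →L[ℝ] ℝ)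
    (x : M) (u v : E) :
    inChart B x (extChartAt 𝓘(ℝ, E) x x) u v = (B x : E →L[ℝ] E →L[ℝ] ℝ) u v := by
  have h1 : ∀ y, y = x → (B y : E →L[ℝ] E →L[ℝ] ℝ) = (B x : E →L[ℝ] E →L[ℝ] ℝ) := by
    rintro y rfl; rfl
  have h2 := h1 _ (extChartAt_to_inv (I := 𝓘(ℝ, E)) x)
  rw [← h2]
  have h3 := mfderiv_extChartAt_symm_self (E := E) (M := M) x
  exact congrArg₂ (fun a b => (B ((extChartAt 𝓘(ℝ, E) x).symm (extChartAt 𝓘(ℝ, E) x x)) :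
    E →L[ℝ] E →L[ℝ] ℝ) a b) (h3 u) (h3 v)

theorem inChart_metric_self_pos (g : Metric E M) (x : M) (v : E) (hv : v ≠ 0) :
    0 < inChart g.inner x (extChartAt 𝓘(ℝ, E) x x) v v := by
  rw [inChart_self]
  exact g.pos x v hv

theorem inChart_metric_symm (g : Metric E M) (x : M) (q u v : E) :
    inChart g.inner x q u v = inChart g.inner x q v u := by
  simp only [inChart_apply]
  exact g.symm _ _ _

theorem differentiableAt_inChart_metric (g : Metric E M) (x : M) (u v : E) :
    DifferentiableAt ℝ (fun q => inChart g.inner x q u v) (extChartAt 𝓘(ℝ, E) x x) := by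
  set χ := extChartAt 𝓘(ℝ, E) x
  set p := χ x
  -- The coordinate vector fields are `C¹` sections along the inverse chart; pairing two of them
  -- with the metric section gives the coefficient functions.
  have hsec : ∀ b : E, ContMDiffAt 𝓘(ℝ, E) 𝓘(ℝ, E).tangent 1
      (fun z => (⟨χ.symm z, mfderiv 𝓘(ℝ, E) 𝓘(ℝ, E) χ.symm z b⟩ : TangentBundle 𝓘(ℝ, E) M)) p := by
    intro b
    have ho : IsOpen χ.target := isOpen_extChartAt_target x
    have hp : p ∈ χ.target := mem_extChartAt_target x
    have h1 := (contMDiffOn_extChartAt_symm (I := 𝓘(ℝ, E)) (n := ∞) x).contMDiffOn_tangentMapWithin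
      (m := 1) (by norm_cast) ho.uniqueMDiffOn
    have h2 : ContMDiffAt 𝓘(ℝ, E) 𝓘(ℝ, E).tangent 1
        (fun z => (⟨z, b⟩ : TangentBundle 𝓘(ℝ, E) E)) p :=
      contMDiffAt_vectorSpace_iff_contDiffAt.2 contDiffAt_const
    have h3 := (h1 ⟨p, b⟩ hp).comp_of_eq (s := χ.target) h2.contMDiffWithinAt (fun z hz => hz) rfl
    refine (h3.contMDiffAt (ho.mem_nhds hp)).congr_of_eventuallyEq ?_
    filter_upwards [ho.mem_nhds hp] with z hz
    have h4 : mfderivWithin 𝓘(ℝ, E) 𝓘(ℝ, E) χ.symm χ.target z = mfderiv 𝓘(ℝ, E) 𝓘(ℝ, E) χ.symm z :=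
      mfderivWithin_of_isOpen ho hz
    change _ = (⟨χ.symm z, mfderivWithin 𝓘(ℝ, E) 𝓘(ℝ, E) χ.symm χ.target z b⟩ :
      TangentBundle 𝓘(ℝ, E) M)
    rw [h4]
  have hg : ContMDiffAt 𝓘(ℝ, E) (𝓘(ℝ, E).prod 𝓘(ℝ, E →L[ℝ] E →L[ℝ] ℝ)) 1
      (fun z => Bundle.TotalSpace.mk' (E →L[ℝ] E →L[ℝ] ℝ)
        (E := fun x : M => TangentSpace 𝓘(ℝ, E) x →L[ℝ] TangentSpace 𝓘(ℝ, E) x →L[ℝ] ℝ)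
        (χ.symm z) (g.inner (χ.symm z))) p :=
    ((g.contMDiff (χ.symm p)).of_le (by norm_cast)).comp p
      ((contMDiffAt_extChartAt_symm x).of_le (by norm_cast))
  have h := ContMDiffAt.clm_bundle_apply₂ (F₁ := E) (F₂ := E) (F₃ := ℝ)
    (E₃ := fun _ : M => ℝ) hg (hsec u) (hsec v)
  simp only [Bundle.contMDiffAt_totalSpace] at h
  exact (contMDiffAt_iff_contDiffAt.1 h.2).differentiableAt (by simp)

/-- The Koszul formula characterising the Christoffel symbols at the centre of a chart. -/
theorem inner_christoffel [FiniteDimensional ℝ E] (g : Metric E M) (x : M) (u v w : E) :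
    let G := inChart g.inner x
    let q := extChartAt 𝓘(ℝ, E) x x
    2 * G q (christoffel g x q u v) w = fderiv ℝ (fun p => G p v w) q u
      + fderiv ℝ (fun p => G p u w) q v - fderiv ℝ (fun p => G p u v) q w := by
  intro G q
  have hGq : G q = (g.inner x : E →L[ℝ] E →L[ℝ] ℝ) := by
    ext a b; exact inChart_self g.inner x a b
  have hdiff : ∀ a, HasFDerivAt (fun p => G p a) (fderiv ℝ (fun p => G p a) q) q := by
    intro a
    refine DifferentiableAt.hasFDerivAt ?_
    exact differentiableAt_dual_of_apply fun b => differentiableAt_inChart_metric g x a b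
  have happ : ∀ a b c, fderiv ℝ (fun p => G p a) q c b = fderiv ℝ (fun p => G p a b) q c := by
    intro a b c
    rw [((hdiff a).clm_apply (hasFDerivAt_const b q)).fderiv]
    simp
  have hinv : (G q).IsInvertible := hGq ▸ inner_isInvertible g x
  have h1 := (hinv.inverse_apply_eq (x := christoffel g x q u v)).1 rfl
  have h2 := congrArg (fun l : E →L[ℝ] ℝ => l w) h1
  rw [show G q (christoffel g x q u v) w = _ from h2.symm]
  change 2 * (1 / 2 * (fderiv ℝ (fun p => G p v) q u w + fderiv ℝ (fun p => G p u) q v w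
    - fderiv ℝ (fun p => G p u v) q w)) = _
  rw [happ, happ]
  ring

end RealCharts
end VPHM

/-! ### Holomorphic charts and Christoffel symbols of Kähler metrics. -/

namespace VPHM
section ComplexCharts

variable {F : Type*} [NormedAddCommGroup F] [NormedSpace ℂ F]
  {N : Type*} [TopologicalSpace N] [ChartedSpace F N] [IsManifold 𝓘(ℂ, F) ω N]

/-- The inverse of a holomorphic chart has complex linear derivatives. -/
theorem mfderiv_extChartAt_symm_I_smul (y : N) {z : F} (hz : z ∈ (extChartAt 𝓘(ℝ, F) y).target)
    (u : F) :
    let D : F →L[ℝ] F := mfderiv 𝓘(ℝ, F) 𝓘(ℝ, F) (extChartAt 𝓘(ℝ, F) y).symm z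
    D (Complex.I • u) = Complex.I • D u := by
  intro D₀
  have hz' : z ∈ (extChartAt 𝓘(ℂ, F) y).target := hz
  have hd : MDifferentiableAt 𝓘(ℂ, F) 𝓘(ℂ, F) (extChartAt 𝓘(ℂ, F) y).symm z :=
    ((contMDiffOn_extChartAt_symm (n := ω) y).contMDiffAt
      ((isOpen_extChartAt_target y).mem_nhds hz')).mdifferentiableAt (by simp)
  have h1 := hd.hasMFDerivAt
  let D : F →L[ℂ] F := mfderiv 𝓘(ℂ, F) 𝓘(ℂ, F) (extChartAt 𝓘(ℂ, F) y).symm z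
  -- The real and complex charts are the same maps, so the complex derivative restricted to real
  -- scalars is the real derivative.
  have h2 : HasMFDerivAt 𝓘(ℝ, F) 𝓘(ℝ, F) (extChartAt 𝓘(ℝ, F) y).symm z (D.restrictScalars ℝ) :=
    ⟨h1.1, HasFDerivWithinAt.restrictScalars ℝ h1.2⟩
  rw [show D₀ = D.restrictScalars ℝ from h2.mfderiv]
  exact D.map_smul Complex.I u

variable {h : Metric F N}

theorem eventually_inChart_I_smul_I_smul (hK : IsKahler h) (y : N) :
    ∀ᶠ z in 𝓝 (extChartAt 𝓘(ℝ, F) y y), ∀ u v : F,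
      inChart h.inner y z (Complex.I • u) (Complex.I • v) = inChart h.inner y z u v := by
  filter_upwards [extChartAt_target_mem_nhds (I := 𝓘(ℝ, F)) y] with z hz u v
  simp only [inChart_apply]
  have hD := mfderiv_extChartAt_symm_I_smul y hz
  have h1 := hK.hermitian ((extChartAt 𝓘(ℝ, F) y).symm z)
  exact (congrArg₂ (fun a b => (h.inner ((extChartAt 𝓘(ℝ, F) y).symm z) : F →L[ℝ] F →L[ℝ] ℝ) a b)
    (hD u) (hD v)).trans (h1 _ _)

theorem eventually_inChart_fundamentalForm (h : Metric F N) (y : N) :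
    ∀ᶠ z in 𝓝 (extChartAt 𝓘(ℝ, F) y y), ∀ u v : F,
      inChart (fundamentalForm h) y z u v = inChart h.inner y z (Complex.I • u) v := by
  filter_upwards [extChartAt_target_mem_nhds (I := 𝓘(ℝ, F)) y] with z hz u v
  simp only [inChart_apply]
  have hD := mfderiv_extChartAt_symm_I_smul y hz
  exact (congrArg (fun a => (h.inner ((extChartAt 𝓘(ℝ, F) y).symm z) : F →L[ℝ] F →L[ℝ] ℝ) a
    (mfderiv 𝓘(ℝ, F) 𝓘(ℝ, F) (extChartAt 𝓘(ℝ, F) y).symm z v)) (hD u)).symm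

variable [FiniteDimensional ℂ F]

/-- Bilinearity and symmetry are hidden by the definition through an inverse operator. Pairing with
an arbitrary `w` turns them into properties of the Koszul expression; this also drives the next two
lemmas. -/
theorem christoffel_comm (h : Metric F N) (y : N) (u v : F) :
    christoffel h y (extChartAt 𝓘(ℝ, F) y y) u v
      = christoffel h y (extChartAt 𝓘(ℝ, F) y y) v u := by
  refine bilin_ext _ (inChart_metric_self_pos h y) fun w => ?_
  have h1 := inner_christoffel h y u v w
  have h2 := inner_christoffel h y v u w
  simp only [inChart_metric_symm h y _ v u] at h1 h2
  linarith

theorem christoffel_add_left (h : Metric F N) (y : N) (u u' v : F) :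
    christoffel h y (extChartAt 𝓘(ℝ, F) y y) (u + u') v
      = christoffel h y (extChartAt 𝓘(ℝ, F) y y) u v
        + christoffel h y (extChartAt 𝓘(ℝ, F) y y) u' v := by
  refine bilin_ext _ (inChart_metric_self_pos h y) fun w => ?_
  have h0 := inner_christoffel h y (u + u') v w
  have h1 := inner_christoffel h y u v w
  have h2 := inner_christoffel h y u' v w
  have hd := differentiableAt_inChart_metric h y
  simp only [map_add, add_apply] at h0 ⊢
  rw [fderiv_fun_add (hd u w) (hd u' w), fderiv_fun_add (hd u v) (hd u' v)] at h0
  simp only [add_apply] at h0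
  linarith

theorem christoffel_smul_left (h : Metric F N) (y : N) (c : ℝ) (u v : F) :
    christoffel h y (extChartAt 𝓘(ℝ, F) y y) (c • u) v
      = c • christoffel h y (extChartAt 𝓘(ℝ, F) y y) u v := by
  refine bilin_ext _ (inChart_metric_self_pos h y) fun w => ?_
  have h0 := inner_christoffel h y (c • u) v w
  have h1 := inner_christoffel h y u v w
  have hd := differentiableAt_inChart_metric h y
  simp only [map_smul, smul_apply, smul_eq_mul] at h0 ⊢
  rw [fderiv_const_mul (hd u w), fderiv_const_mul (hd u v)] at h0
  simp only [smul_apply, smul_eq_mul] at h0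
  linear_combination h0 / 2 - c / 2 * h1

/-- The Christoffel symbols of a Kähler metric in holomorphic coordinates are complex linear. -/
theorem christoffel_I_smul_left (hK : IsKahler h) (y : N) (u v : F) :
    christoffel h y (extChartAt 𝓘(ℝ, F) y y) (Complex.I • u) v
      = Complex.I • christoffel h y (extChartAt 𝓘(ℝ, F) y y) u v := by
  refine bilin_ext _ (inChart_metric_self_pos h y) fun w => ?_
  set p := extChartAt 𝓘(ℝ, F) y y
  let D : F → F → F → ℝ := fun a b c => fderiv ℝ (fun z => inChart h.inner y z b c) p a
  have hJ := eventually_inChart_I_smul_I_smul hK y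
  have hskew : ∀ a b c, D a b (Complex.I • c) = -D a (Complex.I • b) c := by
    intro a b c
    have h1 : (fun z => inChart h.inner y z b (Complex.I • c))
        =ᶠ[𝓝 p] fun z => -inChart h.inner y z (Complex.I • b) c := by
      filter_upwards [hJ] with z hz
      exact hermitian_skew _ hz b c
    simp only [D]
    rw [h1.fderiv_eq, fderiv_fun_neg]
    rfl
  have hcomm : ∀ a b c, D a b c = D a c b := by
    intro a b c
    simp only [D, inChart_metric_symm h y _ b c]
  have hclosed : ∀ a b c, D a (Complex.I • b) c + D b (Complex.I • c) a
      + D c (Complex.I • a) b = 0 := by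
    intro a b c
    have h1 : ∀ b c, (fun z => inChart (fundamentalForm h) y z b c)
        =ᶠ[𝓝 p] fun z => inChart h.inner y z (Complex.I • b) c := by
      intro b c
      filter_upwards [eventually_inChart_fundamentalForm h y] with z hz
      exact hz b c
    have h2 := hK.closed y a b c
    simp only at h2
    rw [(h1 b c).fderiv_eq, (h1 c a).fderiv_eq, (h1 a b).fderiv_eq] at h2
    exact h2
  have hneg : ∀ a b c, D a (-b) c = -D a b c := by
    intro a b c
    simp only [D, map_neg, neg_apply, fderiv_fun_neg]
  have hneg' : ∀ a b c, D (-a) b c = -D a b c := by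
    intro a b c
    simp only [D, map_neg]
  have hII : ∀ a : F, Complex.I • Complex.I • a = -a := by
    intro a; simp [smul_smul]
  have e0 : 2 * inChart h.inner y p (christoffel h y p (Complex.I • u) v) w
      = D (Complex.I • u) v w + D v (Complex.I • u) w - D w (Complex.I • u) v :=
    inner_christoffel h y (Complex.I • u) v w
  have e1 : 2 * inChart h.inner y p (christoffel h y p u v) (Complex.I • w)
      = D u v (Complex.I • w) + D v u (Complex.I • w) - D (Complex.I • w) u v :=
    inner_christoffel h y u v (Complex.I • w)
  have e2 := hermitian_skew _ hJ.self_of_nhds (christoffel h y p u v) w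
  -- Closedness is needed at `(u, v, w)` and at `(Iu, v, Iw)`. After `I` is moved between slots by
  -- skewness, these two identities cancel everything left in the sum of the Koszul expressions `e0`
  -- and `e1`.
  have c1 := hclosed u v w
  have c2 := hclosed (Complex.I • u) v (Complex.I • w)
  simp only [hII, hneg] at c2
  have s1 := hskew u v w
  have s2 := hskew v u w
  have s3 := hskew (Complex.I • u) (Complex.I • v) w
  rw [hII, hneg] at s3
  have s4 := hskew v w u
  have s5 := hcomm v (Complex.I • w) u
  have s6 := hcomm v (Complex.I • u) w
  linarith

end ComplexCharts

/-! ### Second derivatives of compositions and of holomorphic functions. -/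

theorem fderiv_fderiv_comp {E F A : Type*} [NormedAddCommGroup E] [NormedSpace ℝ E]
    [NormedAddCommGroup F] [NormedSpace ℝ F] [NormedAddCommGroup A] [NormedSpace ℝ A]
    {f : F → A} {φ : E → F} {q : E} (hf : ContDiffAt ℝ 2 f (φ q)) (hφ : ContDiffAt ℝ 2 φ q)
    (u v : E) :
    fderiv ℝ (fderiv ℝ (f ∘ φ)) q u v
      = fderiv ℝ (fderiv ℝ f) (φ q) (fderiv ℝ φ q u) (fderiv ℝ φ q v)
        + fderiv ℝ f (φ q) (fderiv ℝ (fderiv ℝ φ) q u v) := by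
  have h1 : fderiv ℝ (f ∘ φ) =ᶠ[𝓝 q] fun z => (fderiv ℝ f (φ z)).comp (fderiv ℝ φ z) := by
    filter_upwards [hφ.eventually (by simp),
      hφ.continuousAt.eventually (hf.eventually (by simp))] with z hz hz'
    exact fderiv_comp z (hz'.differentiableAt (by simp)) (hz.differentiableAt (by simp))
  have hf' : DifferentiableAt ℝ (fderiv ℝ f) (φ q) :=
    (hf.fderiv_right (m := 1) (by norm_num)).differentiableAt (by simp)
  have hφ' : DifferentiableAt ℝ (fderiv ℝ φ) q :=
    (hφ.fderiv_right (m := 1) (by norm_num)).differentiableAt (by simp)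
  have h2 := (hf'.hasFDerivAt.comp q (hφ.differentiableAt (by simp)).hasFDerivAt).clm_comp
    hφ'.hasFDerivAt
  rw [(h2.congr_of_eventuallyEq h1).fderiv]
  simp [add_comm]

/-- The real second derivative of a holomorphic function is complex bilinear. -/
theorem fderiv_fderiv_I_smul_I_smul {F A : Type*} [NormedAddCommGroup F] [NormedSpace ℂ F]
    [NormedAddCommGroup A] [NormedSpace ℂ A] {f : F → A} {p : F} (hf : ContDiffAt ℂ 2 f p)
    (u v : F) :
    fderiv ℝ (fderiv ℝ f) p (Complex.I • u) (Complex.I • v) = -fderiv ℝ (fderiv ℝ f) p u v := by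
  have h1 : fderiv ℝ f =ᶠ[𝓝 p] fun z => (fderiv ℂ f z).restrictScalars ℝ := by
    filter_upwards [hf.eventually (by simp)] with z hz
    exact (hz.differentiableAt (by simp)).fderiv_restrictScalars ℝ
  have hf' : DifferentiableAt ℂ (fderiv ℂ f) p :=
    (hf.fderiv_right (m := 1) (by norm_num)).differentiableAt (by simp)
  have h2 := (ContinuousLinearMap.restrictScalarsL ℂ F A ℝ ℝ).hasFDerivAt.comp p
    (hf'.hasFDerivAt.restrictScalars ℝ)
  rw [(h2.congr_of_eventuallyEq h1).fderiv]
  simp [smul_smul]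

end VPHM

/-! ### Coordinate formulas for the tension field and the Laplacian of a composition. -/

namespace VPHM
section Coordinates

variable {E : Type*} [NormedAddCommGroup E] [NormedSpace ℝ E]
  {M : Type*} [TopologicalSpace M] [ChartedSpace E M]
  {F : Type*} [NormedAddCommGroup F] [NormedSpace ℝ F]
  {N : Type*} [TopologicalSpace N] [ChartedSpace F N]

/-- The expression of a map in the charts centred at `x` and at its image. -/
def inCharts (φ : M → N) (x : M) : E → F :=
  extChartAt 𝓘(ℝ, F) (φ x) ∘ φ ∘ (extChartAt 𝓘(ℝ, E) x).symm

theorem inCharts_self (φ : M → N) (x : M) :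
    inCharts (E := E) (F := F) φ x (extChartAt 𝓘(ℝ, E) x x) = extChartAt 𝓘(ℝ, F) (φ x) (φ x) := by
  simp only [inCharts, Function.comp, extChartAt_to_inv]

theorem mfderiv_eq_fderiv_inCharts {φ : M → N} {x : M}
    (hφ : MDifferentiableAt 𝓘(ℝ, E) 𝓘(ℝ, F) φ x) (u : E) :
    (mfderiv 𝓘(ℝ, E) 𝓘(ℝ, F) φ x u : F)
      = fderiv ℝ (inCharts (E := E) (F := F) φ x) (extChartAt 𝓘(ℝ, E) x x) u := by
  have h := hφ.mfderiv
  simp only [ModelWithCorners.range_eq_univ, fderivWithin_univ] at h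
  exact congrArg (fun A : E →L[ℝ] F => A u) h

theorem contDiffAt_inCharts {φ : M → N} {x : M}
    (hφ : ContMDiffAt 𝓘(ℝ, E) 𝓘(ℝ, F) ∞ φ x) :
    ContDiffAt ℝ ∞ (inCharts (E := E) (F := F) φ x) (extChartAt 𝓘(ℝ, E) x x) := by
  have h := (contMDiffAt_iff.1 hφ).2
  rw [ModelWithCorners.range_eq_univ, contDiffWithinAt_univ] at h
  exact h

variable [FiniteDimensional ℝ E] [IsManifold 𝓘(ℝ, E) ∞ M]

/-- The part of the `V`-tension field in coordinates that does not involve the metric of the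
target. -/
def coordTension (g : Metric E M) (V : ∀ x : M, TangentSpace 𝓘(ℝ, E) x) (φ : M → N) (x : M) : F :=
  let q := extChartAt 𝓘(ℝ, E) x x
  let φ' : E → F := inCharts φ x
  metricTrace (inChart g.inner x q) (fun u v =>
    fderiv ℝ (fderiv ℝ φ') q u v - fderiv ℝ φ' q (christoffel g x q u v)) + fderiv ℝ φ' q (V x)

/-- Isolates the only term that depends on the metric of the target; no outer Jacobian remains,
since the inverse chart has identity derivative at the centre. -/
theorem vTensionField_eq [IsManifold 𝓘(ℝ, F) ∞ N] (g : Metric E M) (h : Metric F N)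
    (V : ∀ x : M, TangentSpace 𝓘(ℝ, E) x) {φ : M → N} {x : M}
    (hφ : MDifferentiableAt 𝓘(ℝ, E) 𝓘(ℝ, F) φ x) :
    let q := extChartAt 𝓘(ℝ, E) x x
    let T := fderiv ℝ (inCharts (E := E) (F := F) φ x) q
    let τ : F := vTensionField g h V φ x
    τ = coordTension g V φ x
      + metricTrace (inChart g.inner x q) (fun u v =>
          christoffel h (φ x) (extChartAt 𝓘(ℝ, F) (φ x) (φ x)) (T u) (T v)) := by
  intro q T τ
  let τ₀ : F := tensionField g h φ x
  let W : F := mfderiv 𝓘(ℝ, E) 𝓘(ℝ, F) φ x (V x)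
  have h1 : τ₀ = metricTrace (inChart g.inner x q) (fun u v =>
      fderiv ℝ (fderiv ℝ (inCharts φ x)) q u v - T (christoffel g x q u v)
        + christoffel h (φ x) (extChartAt 𝓘(ℝ, F) (φ x) (φ x)) (T u) (T v)) :=
    mfderiv_extChartAt_symm_self (φ x) _
  have h2 : W = T (V x) := mfderiv_eq_fderiv_inCharts hφ (V x)
  change τ₀ + W = _
  rw [h1, h2, metricTrace_add]
  simp only [coordTension]
  exact add_right_comm _ _ _

/-- The composition formula for the `V`-Laplacian, in coordinates. -/
theorem vLaplacian_comp_eq {A : Type*} [NormedAddCommGroup A] [NormedSpace ℝ A]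
    (g : Metric E M) (V : ∀ x : M, TangentSpace 𝓘(ℝ, E) x) {φ : M → N} {x : M}
    (hφ : ContMDiffAt 𝓘(ℝ, E) 𝓘(ℝ, F) ∞ φ x) {f : N → A}
    (hfφ : MDifferentiableAt 𝓘(ℝ, E) 𝓘(ℝ, A) (f ∘ φ) x) {f' : F → A}
    (hff' : f ∘ (extChartAt 𝓘(ℝ, F) (φ x)).symm =ᶠ[𝓝 (extChartAt 𝓘(ℝ, F) (φ x) (φ x))] f')
    (hf' : ContDiffAt ℝ 2 f' (extChartAt 𝓘(ℝ, F) (φ x) (φ x))) :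
    let q := extChartAt 𝓘(ℝ, E) x x
    let p := extChartAt 𝓘(ℝ, F) (φ x) (φ x)
    let T := fderiv ℝ (inCharts (E := E) (F := F) φ x) q
    vLaplacian g V (f ∘ φ) x
      = metricTrace (inChart g.inner x q) (fun u v => fderiv ℝ (fderiv ℝ f') p (T u) (T v))
        + fderiv ℝ f' p (coordTension g V φ x) := by
  intro q p T
  have hp : inCharts (E := E) (F := F) φ x q = p := inCharts_self φ x
  have hφ' := contDiffAt_inCharts hφ
  -- The identity is only local: `φ` must land in the source of the target chart, which continuity
  -- ensures near `q`. Agreement of germs is enough for both derivatives.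
  have hloc : f ∘ φ ∘ (extChartAt 𝓘(ℝ, E) x).symm =ᶠ[𝓝 q] f' ∘ inCharts φ x := by
    have h1 : Tendsto (inCharts (E := E) (F := F) φ x) (𝓝 q) (𝓝 p) :=
      hp ▸ hφ'.continuousAt.tendsto
    have h2 : ∀ᶠ z in 𝓝 q, φ ((extChartAt 𝓘(ℝ, E) x).symm z)
        ∈ (extChartAt 𝓘(ℝ, F) (φ x)).source := by
      have h3 : Tendsto (extChartAt 𝓘(ℝ, E) x).symm (𝓝 q) (𝓝 x) := by
        have := (continuousAt_extChartAt_symm (I := 𝓘(ℝ, E)) x).tendsto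
        rwa [extChartAt_to_inv] at this
      exact (hφ.continuousAt.tendsto.comp h3).eventually (extChartAt_source_mem_nhds (φ x))
    filter_upwards [h1.eventually hff', h2] with z hz hz'
    rw [Function.comp_apply (f := f'), ← hz]
    simp only [inCharts, Function.comp]
    rw [(extChartAt 𝓘(ℝ, F) (φ x)).left_inv hz']
  have hf'q : ContDiffAt ℝ 2 f' (inCharts (E := E) (F := F) φ x q) := hp ▸ hf'
  have hφ2 : ContDiffAt ℝ 2 (inCharts (E := E) (F := F) φ x) q := hφ'.of_le (by norm_cast)
  have hD : fderiv ℝ (f ∘ φ ∘ (extChartAt 𝓘(ℝ, E) x).symm) q = (fderiv ℝ f' p).comp T := by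
    rw [hloc.fderiv_eq, fderiv_comp q (hf'q.differentiableAt (by simp))
      (hφ2.differentiableAt (by simp)), hp]
  have hDD : ∀ u v, fderiv ℝ (fderiv ℝ (f ∘ φ ∘ (extChartAt 𝓘(ℝ, E) x).symm)) q u v
      = fderiv ℝ (fderiv ℝ f') p (T u) (T v)
        + fderiv ℝ f' p (fderiv ℝ (fderiv ℝ (inCharts φ x)) q u v) := by
    intro u v
    rw [(hloc.fderiv).fderiv_eq, fderiv_fderiv_comp hf'q hφ2, hp]
  let W : A := mfderiv 𝓘(ℝ, E) 𝓘(ℝ, A) (f ∘ φ) x (V x)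
  have hV : W = fderiv ℝ f' p (T (V x)) := by
    have := mfderiv_eq_fderiv_inCharts hfφ (V x)
    refine this.trans ?_
    change fderiv ℝ (f ∘ φ ∘ (extChartAt 𝓘(ℝ, E) x).symm) q (V x) = _
    rw [hD]
    rfl
  have hL : laplacian g (f ∘ φ) x = metricTrace (inChart g.inner x q) (fun u v =>
      fderiv ℝ (fderiv ℝ f') p (T u) (T v)
        + fderiv ℝ f' p (fderiv ℝ (fderiv ℝ (inCharts φ x)) q u v
          - T (christoffel g x q u v))) := by
    change metricTrace (inChart g.inner x q) (fun u v =>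
      fderiv ℝ (fderiv ℝ (f ∘ φ ∘ (extChartAt 𝓘(ℝ, E) x).symm)) q u v
        - fderiv ℝ (f ∘ φ ∘ (extChartAt 𝓘(ℝ, E) x).symm) q (christoffel g x q u v)) = _
    congr 1
    funext u v
    rw [hDD, hD, map_sub]
    simp only [ContinuousLinearMap.comp_apply]
    abel
  change laplacian g (f ∘ φ) x + W = _
  have hc : fderiv ℝ f' p (coordTension g V φ x)
      = metricTrace (inChart g.inner x q) (fun u v => fderiv ℝ f' p
          (fderiv ℝ (fderiv ℝ (inCharts φ x)) q u v - T (christoffel g x q u v)))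
        + fderiv ℝ f' p (T (V x)) :=
    (map_add (fderiv ℝ f' p) _ _).trans
      (congrArg (· + _) (metricTrace_map (fderiv ℝ f' p : F →ₗ[ℝ] A) _ _))
  rw [hL, hV, metricTrace_add, hc]
  exact add_assoc _ _ _

end Coordinates

theorem contMDiffOn_real_of_complex {F : Type*} [NormedAddCommGroup F] [NormedSpace ℂ F]
    {N : Type*} [TopologicalSpace N] [ChartedSpace F N]
    {A : Type*} [NormedAddCommGroup A] [NormedSpace ℂ A] {n : WithTop ℕ∞} {f : N → A} {s : Set N}
    (hf : ContMDiffOn 𝓘(ℂ, F) 𝓘(ℂ, A) n f s) : ContMDiffOn 𝓘(ℝ, F) 𝓘(ℝ, A) n f s := by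
  intro y hy
  have h := contMDiffWithinAt_iff.1 (hf y hy)
  exact contMDiffWithinAt_iff.2 ⟨h.1, h.2.restrict_scalars ℝ⟩

end VPHM

/-! ### The equivalence. -/

section
variable
    {E : Type*} [NormedAddCommGroup E] [NormedSpace ℝ E]
    {M : Type*} [TopologicalSpace M] [ChartedSpace E M] [IsManifold 𝓘(ℝ, E) ∞ M]
    {F : Type*} [NormedAddCommGroup F] [NormedSpace ℂ F]
    {N : Type*} [TopologicalSpace N] [ChartedSpace F N] [IsManifold 𝓘(ℂ, F) ω N]

namespace VPHM

variable {g : Metric E M} {h : Metric F N}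

theorem isPHWC_iff (hφ : MDifferentiable 𝓘(ℝ, E) 𝓘(ℝ, F) (φ : M → N)) :
    IsPHWC g h φ ↔ ∀ (x : M) (w : F),
      let T := fderiv ℝ (inCharts (E := E) (F := F) φ x) (extChartAt 𝓘(ℝ, E) x x)
      let S : F → E := adjointMFDeriv g h φ x
      T (S (Complex.I • w)) = Complex.I • T (S w) := by
  refine forall_congr' fun x => forall_congr' fun w => ?_
  let T := fderiv ℝ (inCharts (E := E) (F := F) φ x) (extChartAt 𝓘(ℝ, E) x x)
  let S : F → E := adjointMFDeriv g h φ x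
  let D : E →L[ℝ] F := mfderiv 𝓘(ℝ, E) 𝓘(ℝ, F) φ x
  let w' : F := w
  have hT : D = T := ContinuousLinearMap.ext (mfderiv_eq_fderiv_inCharts (hφ x))
  change D (S (Complex.I • w')) = Complex.I • D (S w') ↔ T (S (Complex.I • w')) = Complex.I • T (S w')
  rw [hT]

variable [FiniteDimensional ℝ E]

/-- The adjoint of the differential, in coordinates. -/
theorem inChart_adjointMFDeriv (g : Metric E M) (h : Metric F N) {φ : M → N} {x : M}
    (hφ : MDifferentiableAt 𝓘(ℝ, E) 𝓘(ℝ, F) φ x) (w : F) (u : E) :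
    let S : F → E := adjointMFDeriv g h φ x
    inChart g.inner x (extChartAt 𝓘(ℝ, E) x x) (S w) u
      = inChart h.inner (φ x) (extChartAt 𝓘(ℝ, F) (φ x) (φ x)) w
          (fderiv ℝ (inCharts (E := E) (F := F) φ x) (extChartAt 𝓘(ℝ, E) x x) u) := by
  intro S
  rw [inChart_self, inChart_self, ← mfderiv_eq_fderiv_inCharts hφ]
  exact adjoint_spec g h φ x w u

/-- Testing the pull-back property on a function given in the chart centred at `φ x`. -/
theorem PullsBackHolomorphicToVHarmonic.coord_eq_zero
    {V : ∀ x : M, TangentSpace 𝓘(ℝ, E) x} {φ : M → N} (hφ : ContMDiff 𝓘(ℝ, E) 𝓘(ℝ, F) ∞ φ)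
    (H : PullsBackHolomorphicToVHarmonic (F := F) g V φ) (x : M) {f' : F → ℂ}
    (hf' : ContDiff ℂ ω f') :
    let q := extChartAt 𝓘(ℝ, E) x x
    let p := extChartAt 𝓘(ℝ, F) (φ x) (φ x)
    let T := fderiv ℝ (inCharts (E := E) (F := F) φ x) q
    metricTrace (inChart g.inner x q) (fun u v => fderiv ℝ (fderiv ℝ f') p (T u) (T v))
        + fderiv ℝ f' p (coordTension g V φ x) = 0 := by
  intro q p T
  have hW : IsOpen (extChartAt 𝓘(ℝ, F) (φ x)).source := isOpen_extChartAt_source (φ x)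
  have hx : x ∈ φ ⁻¹' (extChartAt 𝓘(ℝ, F) (φ x)).source := mem_extChartAt_source (φ x)
  -- The test function `f'` becomes a local holomorphic function on `N` by composition with the
  -- holomorphic chart.
  have hhol : ContMDiffOn 𝓘(ℂ, F) 𝓘(ℂ, ℂ) ω (f' ∘ extChartAt 𝓘(ℝ, F) (φ x))
      (extChartAt 𝓘(ℝ, F) (φ x)).source := by
    have h1 : ContMDiffOn 𝓘(ℂ, F) 𝓘(ℂ, F) ω (extChartAt 𝓘(ℂ, F) (φ x))
      (chartAt F (φ x)).source := contMDiffOn_extChartAt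
    rw [extChartAt_source]
    exact hf'.contMDiff.comp_contMDiffOn h1
  obtain ⟨hs, hz⟩ := H _ _ hW hhol
  rw [← hz x hx]
  refine (vLaplacian_comp_eq g V (hφ x) ?_ ?_ ?_).symm
  · exact (hs.contMDiffAt ((hW.preimage hφ.continuous).mem_nhds hx)).mdifferentiableAt (by simp)
  · exact (extChartAt_comp_symm_eventuallyEq (φ x)).fun_comp f'
  · exact (hf'.contDiffAt.restrict_scalars ℝ).of_le le_top

/-- The test functions are products of two complex linear forms centred at `p`. Their differential
vanishes at `p`, so the unknown first-order term disappears, and their Hessian is the symmetrised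
product of the forms. -/
theorem isPHWC_of_pullsBack (hK : IsKahler h)
    {V : ∀ x : M, TangentSpace 𝓘(ℝ, E) x} {φ : M → N} (hφ : ContMDiff 𝓘(ℝ, E) 𝓘(ℝ, F) ∞ φ)
    (H : PullsBackHolomorphicToVHarmonic (F := F) g V φ) : IsPHWC g h φ := by
  have hd : MDifferentiable 𝓘(ℝ, E) 𝓘(ℝ, F) φ := hφ.mdifferentiable (by simp)
  refine (isPHWC_iff hd).2 fun x => ?_
  set p := extChartAt 𝓘(ℝ, F) (φ x) (φ x)
  refine comm_of_metricTrace_eq_zero _ (inChart_metric_self_pos g x)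
    (inChart h.inner (φ x) p) (inChart_metric_symm h (φ x) p) (inChart_metric_self_pos h (φ x))
    (eventually_inChart_I_smul_I_smul hK (φ x)).self_of_nhds _ (adjointMFDeriv g h φ x)
    (inChart_adjointMFDeriv g h (hd x)) fun l m => ?_
  set T := fderiv ℝ (inCharts (E := E) (F := F) φ x) (extChartAt 𝓘(ℝ, E) x x)
  let l' : F →L[ℝ] ℂ := l.restrictScalars ℝ
  let m' : F →L[ℝ] ℂ := m.restrictScalars ℝ
  have hf : ContDiff ℂ ω fun z => l (z - p) * m (z - p) := by fun_prop
  have h1 := H.coord_eq_zero hφ x hf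
  have hD : fderiv ℝ (fun z => l (z - p) * m (z - p))
      = fun z => l' (z - p) • m' + m' (z - p) • l' := by
    funext z
    have hl : HasFDerivAt (fun z => l (z - p)) l' z :=
      l'.hasFDerivAt.comp z ((hasFDerivAt_id z).sub_const p)
    have hm : HasFDerivAt (fun z => m (z - p)) m' z :=
      m'.hasFDerivAt.comp z ((hasFDerivAt_id z).sub_const p)
    exact (hl.mul hm).fderiv
  have hDD : ∀ u v, fderiv ℝ (fderiv ℝ fun z => l (z - p) * m (z - p)) p u v
      = l u * m v + m u * l v := by
    intro u v
    rw [hD]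
    have hl : HasFDerivAt (fun z => l' (z - p)) l' p :=
      l'.hasFDerivAt.comp p ((hasFDerivAt_id p).sub_const p)
    have hm : HasFDerivAt (fun z => m' (z - p)) m' p :=
      m'.hasFDerivAt.comp p ((hasFDerivAt_id p).sub_const p)
    rw [((hl.smul_const m').fun_add (hm.smul_const l')).fderiv]
    simp [l', m']
  have hD0 : fderiv ℝ (fun z => l (z - p) * m (z - p)) p = 0 := by
    rw [hD]
    ext
    simp
  simp only [p, hDD, hD0] at h1
  rw [zero_apply, add_zero, metricTrace_add] at h1
  -- Both halves of the symmetrised Hessian have the same trace, so each of them vanishes.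
  have h2 := metricTrace_swap (inChart g.inner x (extChartAt 𝓘(ℝ, E) x x))
    (inChart_metric_symm g x _) fun u v => l (T u) * m (T v)
  simp only [mul_comm (l _)] at h1 h2 ⊢
  rw [h2, add_self_eq_zero] at h1
  exact h1

variable [FiniteDimensional ℂ F]

/-- Complex bilinear Christoffel symbols satisfy `L(Iu, Iv) = -L(u, v)`, so the algebraic vanishing
criterion applies. -/
theorem metricTrace_christoffel_eq_zero (hK : IsKahler h) {φ : M → N}
    (hφ : MDifferentiable 𝓘(ℝ, E) 𝓘(ℝ, F) φ) (hP : IsPHWC g h φ) (x : M) :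
    let q := extChartAt 𝓘(ℝ, E) x x
    let T := fderiv ℝ (inCharts (E := E) (F := F) φ x) q
    metricTrace (inChart g.inner x q) (fun u v =>
      christoffel h (φ x) (extChartAt 𝓘(ℝ, F) (φ x) (φ x)) (T u) (T v)) = 0 := by
  intro q T
  set p := extChartAt 𝓘(ℝ, F) (φ x) (φ x)
  refine metricTrace_comp_eq_zero _ (inChart_metric_self_pos g x)
    (inChart h.inner (φ x) p) (inChart_metric_self_pos h (φ x))
    (eventually_inChart_I_smul_I_smul hK (φ x)).self_of_nhds T (adjointMFDeriv g h φ x)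
    (inChart_adjointMFDeriv g h (hφ x)) ((isPHWC_iff hφ).1 hP x)
    (LinearMap.mk₂ ℝ (christoffel h (φ x) p) (christoffel_add_left h (φ x))
      (christoffel_smul_left h (φ x)) ?_ ?_) ?_
  · intro a b c
    simp only [p, christoffel_comm h (φ x) a, christoffel_add_left h (φ x)]
  · intro a b c
    simp only [p, christoffel_comm h (φ x) b, christoffel_smul_left h (φ x)]
  · intro u v
    simp only [LinearMap.mk₂_apply, p]
    rw [christoffel_I_smul_left hK, christoffel_comm h (φ x) u, christoffel_I_smul_left hK, smul_smul,
      Complex.I_mul_I, christoffel_comm h (φ x) u, neg_one_smul]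

theorem vTensionField_eq_coordTension (hK : IsKahler h) (V : ∀ x : M, TangentSpace 𝓘(ℝ, E) x)
    {φ : M → N} (hφ : MDifferentiable 𝓘(ℝ, E) 𝓘(ℝ, F) φ) (hP : IsPHWC g h φ) (x : M) :
    let τ : F := vTensionField g h V φ x
    τ = coordTension g V φ x := by
  intro τ
  refine (vTensionField_eq g h V (hφ x)).trans ?_
  rw [metricTrace_christoffel_eq_zero hK hφ hP, add_zero]

theorem pullsBack_of_isVPseudoHarmonicMorphism (hK : IsKahler h)
    {V : ∀ x : M, TangentSpace 𝓘(ℝ, E) x} {φ : M → N} (hφ : ContMDiff 𝓘(ℝ, E) 𝓘(ℝ, F) ∞ φ)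
    (H : IsVPseudoHarmonicMorphism g h V φ) :
    PullsBackHolomorphicToVHarmonic (F := F) g V φ := by
  intro W f hW hf
  have hs : ContMDiffOn 𝓘(ℝ, E) 𝓘(ℝ, ℂ) ∞ (f ∘ φ) (φ ⁻¹' W) :=
    ((contMDiffOn_real_of_complex hf).of_le (by simp)).comp hφ.contMDiffOn fun _ hx => hx
  have hd : MDifferentiable 𝓘(ℝ, E) 𝓘(ℝ, F) φ := hφ.mdifferentiable (by simp)
  refine ⟨hs, fun x hx => ?_⟩
  have hfφ : MDifferentiableAt 𝓘(ℝ, E) 𝓘(ℝ, ℂ) (f ∘ φ) x :=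
    (hs.contMDiffAt ((hW.preimage hφ.continuous).mem_nhds hx)).mdifferentiableAt (by simp)
  set p := extChartAt 𝓘(ℝ, F) (φ x) (φ x)
  set f' := f ∘ (extChartAt 𝓘(ℝ, F) (φ x)).symm
  have hf' : ContDiffAt ℂ 2 f' p := by
    have h1 := (contMDiffAt_iff.1 (hf.contMDiffAt (hW.mem_nhds hx))).2
    rw [ModelWithCorners.range_eq_univ, contDiffWithinAt_univ] at h1
    exact h1.of_le (by norm_cast)
  rw [vLaplacian_comp_eq g V (hφ x) hfφ (f' := f') EventuallyEq.rfl (hf'.restrict_scalars ℝ)]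
  -- The first-order term is `df'` applied to the `V`-tension field, which is zero; what remains is
  -- the trace of a complex bilinear Hessian.
  rw [show (coordTension g V φ x : F) = 0 from
    (vTensionField_eq_coordTension hK V hd H.phwc x).symm.trans (H.vHarmonic x), map_zero, add_zero]
  exact metricTrace_comp_eq_zero _ (inChart_metric_self_pos g x)
    (inChart h.inner (φ x) p) (inChart_metric_self_pos h (φ x))
    (eventually_inChart_I_smul_I_smul hK (φ x)).self_of_nhds _ (adjointMFDeriv g h φ x)
    (inChart_adjointMFDeriv g h (hd x)) ((isPHWC_iff hd).1 H.phwc x)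
    (LinearMap.mk₂ ℝ (fun u v => fderiv ℝ (fderiv ℝ f') p u v) (by simp) (by simp) (by simp)
      (by simp)) (fderiv_fderiv_I_smul_I_smul hf')

/-- The commutation condition is already available and reduces the `V`-tension field to
`coordTension`. Complex linear coordinate functions have zero Hessian, so each one kills that
vector, and together they separate points. -/
theorem isVHarmonicMap_of_pullsBack (hK : IsKahler h)
    {V : ∀ x : M, TangentSpace 𝓘(ℝ, E) x} {φ : M → N} (hφ : ContMDiff 𝓘(ℝ, E) 𝓘(ℝ, F) ∞ φ)
    (H : PullsBackHolomorphicToVHarmonic (F := F) g V φ) : IsVHarmonicMap g h V φ := by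
  intro x
  refine (vTensionField_eq_coordTension hK V (hφ.mdifferentiable (by simp))
    (isPHWC_of_pullsBack hK hφ H) x).trans ?_
  refine (Module.forall_dual_apply_eq_zero_iff ℂ (coordTension g V φ x : F)).1 fun l => ?_
  let l₁ : F →L[ℂ] ℂ := LinearMap.toContinuousLinearMap l
  let l' : F →L[ℝ] ℂ := l₁.restrictScalars ℝ
  have h1 := H.coord_eq_zero hφ x l₁.contDiff
  have hD : fderiv ℝ l₁ = fun _ => l' := funext fun z => l'.fderiv
  have hDD : fderiv ℝ (fun _ : F => l') = 0 := by funext z; simp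
  simp only [hD, hDD] at h1
  have h0 : metricTrace (inChart g.inner x (extChartAt 𝓘(ℝ, E) x x)) (fun _ _ => (0 : ℂ)) = 0 := by
    simp [metricTrace]
  exact (zero_add _).symm.trans ((congrArg (· + _) h0.symm).trans h1)

end VPHM
end

theorem theorem3p2
    {E : Type*} [NormedAddCommGroup E] [NormedSpace ℝ E] [FiniteDimensional ℝ E]
    {M : Type*} [TopologicalSpace M] [ChartedSpace E M] [IsManifold 𝓘(ℝ, E) ∞ M]
    {F : Type*} [NormedAddCommGroup F] [NormedSpace ℂ F] [FiniteDimensional ℂ F]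
    {N : Type*} [TopologicalSpace N] [ChartedSpace F N] [IsManifold 𝓘(ℂ, F) ω N]
    (g : VPHM.Metric E M) (h : VPHM.Metric F N) (hK : VPHM.IsKahler h)
    (V : ∀ x : M, TangentSpace 𝓘(ℝ, E) x)
    (hV : ContMDiff 𝓘(ℝ, E) 𝓘(ℝ, E).tangent ∞
      (fun x => (⟨x, V x⟩ : TangentBundle 𝓘(ℝ, E) M)))
    (φ : M → N) (hφ : ContMDiff 𝓘(ℝ, E) 𝓘(ℝ, F) ∞ φ) :
    VPHM.IsVPseudoHarmonicMorphism g h V φ ↔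
      VPHM.PullsBackHolomorphicToVHarmonic (F := F) g V φ :=
  ⟨VPHM.pullsBack_of_isVPseudoHarmonicMorphism hK hφ, fun H =>
    ⟨VPHM.isVHarmonicMap_of_pullsBack hK hφ H, VPHM.isPHWC_of_pullsBack hK hφ H⟩⟩
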